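/- Let $X$ be a finite non-empty set, with an abelian group structure that is used to write oracle answers into a register. Write $U_\pi$ for the query unitary of a permutation $\pi$ of $X$: $U_\pi|0\rangle|x\rangle|y\rangle=|0\rangle|x\rangle|y+\pi(x)\rangle$ and $U_\pi|1\rangle|x\rangle|y\rangle=|1\rangle|x\rangle|y+\pi^{-1}(x)\rangle$. A search-type, classically verifiable game $G$ is given by a challenger: a classical, randomized, possibly computationally unbounded and always terminating interactive algorithm that has classical query access to $\pi$ and $\pi^{-1}$, exchanges classical messages alternately with an adversary (the challenger moves first, possibly with a dummy message), and finally accepts or rejects; its queries and messages may depend adaptively on everything it has seen. An adversary with access to the same permutation wins $G$ if the challenger accepts; it loses if it stops before the challenger has decided. A quantum adversary making $q$ quantum queries is an interactive algorithm on a finite-dimensional Hilbert space, with classical messages, that applies unitaries, measurements and in total at most $q$ times $U_\pi$ in every run, where the choice of each action may depend on earlier messages and measurement outcomes. A classical adversary making $k$ queries is a classical, randomized, possibly computationally unbounded interactive algorithm that makes in total at most $k$ classical queries to $\pi$ and $\pi^{-1}$ in every run. **Theorem.** Let $k,q\ge 0$ be integers and let $G$ be a search-type, classically verifiable game whose challenger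 makes in total at most $k$ classical queries to $\pi$ and $\pi^{-1}$. Then for every quantum adversary $\mathcal A$ making at most $q$ quantum queries there is a classical adversary $\mathcal B$ making at most $k$ classical queries such that $$\Pr_{\pi}\left[\mathcal B^{\pi}\text{ wins }G\right]\;\ge\;\frac{1-\frac{k^2}{|X|}}{(8q+1)^{2k}}\;\Pr_{\pi}\left[\mathcal A^{\pi}\text{ wins }G\right],$$ where $\pi$ is a uniformly random permutation of $X$ and the probabilities are also over the randomness of the challenger and the adversary. -/

import Mathlib

open scoped ENNReal

/-! ### Classical interactive oracle algorithms -/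

/-- The answer of the invertible permutation oracle `π` to one classical query: a forward query
(`inv = false`) is answered by `π x`, a backward query (`inv = true`) by `π⁻¹ x`. -/
def oracleAnswer {X : Type*} (π : Equiv.Perm X) (inv : Bool) (x : X) : X :=
  if inv then π.symm x else π x

/-- A classical randomized interactive algorithm with oracle access to an invertible permutation
of `X`, given as its tree of actions. It receives messages in `In`, sends messages in `Out` and
may stop with a result in `R`. It is computationally unbounded, but always terminates.

* `ret r`: stop with result `r`;
* `toss p next`: sample `i` from the discrete distribution `p`, continue with `next i`;
* `query inv x next`: make one classical query, continue with `next` of the answer;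
* `send m next`: send `m`, wait for the other party's next message, continue with `next` of it. -/
inductive ClassicalAlg (X In Out R : Type*) where
  | ret (r : R) : ClassicalAlg X In Out R
  | toss (p : PMF ℕ) (next : ℕ → ClassicalAlg X In Out R) : ClassicalAlg X In Out R
  | query (inv : Bool) (x : X) (next : X → ClassicalAlg X In Out R) : ClassicalAlg X In Out R
  | send (m : Out) (next : In → ClassicalAlg X In Out R) : ClassicalAlg X In Out R

/-- On every run the algorithm makes at most `k` queries (forward and backward ones together). -/
def ClassicalAlg.AtMostQueries {X In Out R : Type*} : ClassicalAlg X In Out R → ℕ → Prop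
  | .ret _, _ => True
  | .toss _ next, k => ∀ i, (next i).AtMostQueries k
  | .query _ _ _, 0 => False
  | .query _ _ next, k + 1 => ∀ y, (next y).AtMostQueries k
  | .send _ next, k => ∀ m, (next m).AtMostQueries k

/-- The challenger of a search-type, classically verifiable game: a classical interactive
algorithm which moves first, receives the messages in `MA` of the adversary, sends messages in
`MC`, and finally outputs whether it accepts (`true`) or rejects (`false`). -/
abbrev Challenger (X MA MC : Type*) := ClassicalAlg X MA MC Bool

/-- A classical adversary: it maps the first message of the challenger to the algorithm that it
runs from then on. It has no output of its own. -/
abbrev ClassicalAdversary (X MA MC : Type*) := MC → ClassicalAlg X MC MA Unit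

/-! ### Quantum interactive oracle algorithms -/

/-- Labels of the computational basis: the direction bit, the query input register, the query
answer register, and the work register with basis labels `W`. -/
abbrev Reg (X W : Type*) := Bool × X × X × W

/-- The Hilbert space of the quantum adversary. -/
abbrev QState (X W : Type*) := EuclideanSpace ℂ (Reg X W)

/-- The action of a query on basis labels: `(b, x, y, w) ↦ (b, x, y + π x, w)` for `b = false`
and `(b, x, y, w) ↦ (b, x, y + π⁻¹ x, w)` for `b = true`. -/
def queryPerm {X W : Type*} [AddCommGroup X] (π : Equiv.Perm X) : Equiv.Perm (Reg X W) where
  toFun := fun (b, x, y, w) => (b, x, y + oracleAnswer π b x, w)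
  invFun := fun (b, x, y, w) => (b, x, y - oracleAnswer π b x, w)
  left_inv := fun (b, x, y, w) => by simp
  right_inv := fun (b, x, y, w) => by simp

/-- The query unitary `U_π`, the linear extension of `|i⟩ ↦ |queryPerm π i⟩`. -/
noncomputable def queryUnitary {X W : Type*} [Fintype X] [AddCommGroup X] [Fintype W]
    (π : Equiv.Perm X) : QState X W ≃ₗᵢ[ℂ] QState X W :=
  LinearIsometryEquiv.piLpCongrLeft 2 ℂ ℂ (queryPerm π)

open Classical in
/-- The unnormalized state after a measurement of the value of `f` with outcome `o`: the
orthogonal projection of `ψ` to the span of the basis vectors `|i⟩` with `f i = o`. -/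
noncomputable def postMeasure {X W : Type*} (f : Reg X W → ℕ) (o : ℕ) (ψ : QState X W) :
    QState X W :=
  WithLp.toLp 2 fun i => if f i = o then ψ i else 0

/-- A quantum interactive oracle algorithm with classical communication, given as its tree of
actions.

* `halt`: stop;
* `gate U next`: apply the unitary `U`;
* `measure f next`: measure the value `f i` of the computational basis label `i`, continue with
  `next` of the outcome;
* `query next`: make one quantum query, i.e. apply `U_π`;
* `send m next`: send the classical message `m`, wait for the other party's next message, continue
  with `next` of it. -/
inductive QuantumAlg (X W In Out : Type*) [Fintype X] [Fintype W] where
  | halt : QuantumAlg X W In Out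
  | gate (U : QState X W ≃ₗᵢ[ℂ] QState X W) (next : QuantumAlg X W In Out) :
      QuantumAlg X W In Out
  | measure (f : Reg X W → ℕ) (next : ℕ → QuantumAlg X W In Out) : QuantumAlg X W In Out
  | query (next : QuantumAlg X W In Out) : QuantumAlg X W In Out
  | send (m : Out) (next : In → QuantumAlg X W In Out) : QuantumAlg X W In Out

/-- On every run the algorithm makes at most `q` quantum queries. -/
def QuantumAlg.AtMostQueries {X W In Out : Type*} [Fintype X] [Fintype W] :
    QuantumAlg X W In Out → ℕ → Prop
  | .halt, _ => True
  | .gate _ next, q => next.AtMostQueries q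
  | .measure _ next, q => ∀ o, (next o).AtMostQueries q
  | .query _, 0 => False
  | .query next, q + 1 => next.AtMostQueries q
  | .send _ next, q => ∀ m, (next m).AtMostQueries q

/-- A quantum adversary: a pure initial state and a map from the first message of the challenger
to the algorithm that the adversary runs from then on. -/
structure QuantumAdversary (X W MA MC : Type*) [Fintype X] [Fintype W] where
  init : QState X W
  norm_init : ‖init‖ = 1
  strategy : MC → QuantumAlg X W MC MA

/-! ### Playing the game -/

section Play

variable {X W MA MC : Type*}

/-- Run a classical adversary on the oracle `π` up to its next message `m`; `κ m next` is the
probability that the challenger, who then receives `m`, accepts in the end if the adversary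
continues with `next`. The value is the probability of acceptance. An adversary that stops without
a message loses. -/
noncomputable def ClassicalAlg.runTurn (π : Equiv.Perm X)
    (κ : MA → ClassicalAdversary X MA MC → ℝ≥0∞) : ClassicalAlg X MC MA Unit → ℝ≥0∞
  | .ret _ => 0
  | .toss p next => ∑' i, p i * (next i).runTurn π κ
  | .query inv x next => (next (oracleAnswer π inv x)).runTurn π κ
  | .send m next => κ m next

/-- The probability that the challenger accepts when it and the classical adversary both have
oracle `π`. -/
noncomputable def Challenger.acceptClassical (π : Equiv.Perm X) :
    Challenger X MA MC → ClassicalAdversary X MA MC → ℝ≥0∞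
  | .ret b, _ => if b then 1 else 0
  | .toss p next, B => ∑' i, p i * Challenger.acceptClassical π (next i) B
  | .query inv x next, B => Challenger.acceptClassical π (next (oracleAnswer π inv x)) B
  | .send m next, B =>
      (B m).runTurn π fun m' B' => Challenger.acceptClassical π (next m') B'

variable [Fintype X] [AddCommGroup X] [Fintype W]

/-- Run a quantum adversary on the oracle `π` from the (unnormalized) state `ψ` up to its next
message, as in `ClassicalAlg.runTurn`. The squared norm of a state is the probability of the
measurement outcomes that led to it. -/
noncomputable def QuantumAlg.runTurn (π : Equiv.Perm X)
    (κ : MA → (MC → QuantumAlg X W MC MA) → QState X W → ℝ≥0∞) :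
    QuantumAlg X W MC MA → QState X W → ℝ≥0∞
  | .halt, _ => 0
  | .gate U next, ψ => next.runTurn π κ (U ψ)
  | .measure f next, ψ =>
      ∑ o ∈ Finset.univ.image f, (next o).runTurn π κ (postMeasure f o ψ)
  | .query next, ψ => next.runTurn π κ (queryUnitary π ψ)
  | .send m next, ψ => κ m next ψ

/-- The probability that the challenger accepts when both it and the quantum adversary, which is
in the (unnormalized) state `ψ`, have oracle `π`. -/
noncomputable def Challenger.acceptQuantum (π : Equiv.Perm X) :
    Challenger X MA MC → (MC → QuantumAlg X W MC MA) → QState X W → ℝ≥0∞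
  | .ret b, _, ψ => if b then ‖ψ‖ₑ ^ 2 else 0
  | .toss p next, A, ψ => ∑' i, p i * Challenger.acceptQuantum π (next i) A ψ
  | .query inv x next, A, ψ =>
      Challenger.acceptQuantum π (next (oracleAnswer π inv x)) A ψ
  | .send m next, A, ψ =>
      (A m).runTurn π (fun m' A' ψ' => Challenger.acceptQuantum π (next m') A' ψ') ψ

end Play

/-- The probability, over a uniformly random permutation `π` of `X` and all randomness of the two
parties, that the classical adversary wins. -/
noncomputable def classicalWinProb {X MA MC : Type*} [Fintype X] [DecidableEq X]
    (G : Challenger X MA MC) (B : ClassicalAdversary X MA MC) : ℝ :=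
  (∑ π : Equiv.Perm X,
    PMF.uniformOfFintype (Equiv.Perm X) π * Challenger.acceptClassical π G B).toReal

/-- The probability, over a uniformly random permutation `π` of `X`, all randomness of the
challenger and all measurements of the adversary, that the quantum adversary wins. -/
noncomputable def quantumWinProb {X W MA MC : Type*} [Fintype X] [DecidableEq X] [AddCommGroup X]
    [Fintype W] (G : Challenger X MA MC) (A : QuantumAdversary X W MA MC) : ℝ :=
  (∑ π : Equiv.Perm X,
    PMF.uniformOfFintype (Equiv.Perm X) π *
      Challenger.acceptQuantum π G A.strategy A.init).toReal

/-! Let a second, independent uniform permutation σ answer the adversary in place of π. Fix a run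
and let R be the set of the at most k inputs whose values under π the challenger has learned. If
σ(R) and π(R) are disjoint, which fails with probability at most k²/|X|, let τ swap every x in R
with σ⁻¹(π x). Then T = σ ∘ τ agrees with π on R, and (π, σ) ↦ (σ ∘ τ, π ∘ τ) is an involution of
the admissible pairs. On average, T may therefore replace π in the quantum run (`sum_exchange`).

It remains to imitate T from σ and at most k values of π. T and σ answer a query differently only if
it meets a pair of π over R, either directly or through the answer of σ. So U_T ψ is U_σ ψ plus a
signed sum of terms in which the query is measured, one classical query reveals the pair, and σ is
reprogrammed there before or after the measured query is answered (`queryUnitary_eq_add_sum`). Every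
such pair uses up a point of R, so a branch has at most k measured queries, and a weighted
Cauchy–Schwarz inequality costs a factor (8q+1)^k (`enorm_sq_evalWord_le`). Sampling the branches
classically, without knowledge of R, costs the same factor again
(`Challenger.acceptFree_simWeight_le`). Finally the best σ is fixed.

Since R depends on the run, winning probabilities are written as sums over runs: a word of linear
maps of the adversary and a set D of pairs of the challenger. These sums are additive and monotone
in the weight of the runs, so it suffices to compare weights for one fixed run
(`sum_bornWeight_le`). -/

/-! ### Reprogramming a permutation -/

section Reprogramming

variable {X : Type*}

/-- The input-output pair of the permutation that is revealed by the answer `a` to the query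
`(inv, z)`. -/
def queryPair (inv : Bool) (z a : X) : X × X := if inv then (a, z) else (z, a)

/-- The permutation `σ`, changed so that it maps `p.1` to `p.2`. -/
def reprogram [DecidableEq X] (σ : Equiv.Perm X) (p : X × X) : Equiv.Perm X :=
  (Equiv.swap p.1 (σ.symm p.2)).trans σ

/-- The values of `σ` on `R` avoid the values of `π` on `R`. -/
def GenericOn (π σ : Equiv.Perm X) (R : Finset X) : Prop := ∀ x ∈ R, ∀ x' ∈ R, σ x ≠ π x'

instance [DecidableEq X] (π σ : Equiv.Perm X) (R : Finset X) : Decidable (GenericOn π σ R) := by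
  unfold GenericOn; infer_instance

/-- `T` is obtained from `σ` by reprogramming it to agree with `π` on `R`. -/
structure IsReprogramming (π σ : Equiv.Perm X) (R : Finset X) (T : Equiv.Perm X) : Prop where
  on_mem : ∀ x ∈ R, T x = π x
  on_image : ∀ x, π.symm (σ x) ∈ R → T x = σ (π.symm (σ x))
  on_compl : ∀ x, x ∉ R → π.symm (σ x) ∉ R → T x = σ x

theorem IsReprogramming.eq_of_empty {π σ T : Equiv.Perm X} (hT : IsReprogramming π σ ∅ T) :
    T = σ :=
  Equiv.ext fun x => hT.on_compl x (by simp) (by simp)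

/-- The query to the real permutation `π` that is made after the query `(b, x)` to the simulated
permutation `σ` was measured: the same query, or (if `ind`) the inverse query at the simulated
answer. -/
def followUp (σ : Equiv.Perm X) (ind b : Bool) (x : X) : Bool × X :=
  if ind then (!b, oracleAnswer σ b x) else (b, x)

/-- The input-output pair of `π` that is revealed by the follow-up query. -/
def revealedPair (π σ : Equiv.Perm X) (ind b : Bool) (x : X) : X × X :=
  queryPair (followUp σ ind b x).1 (followUp σ ind b x).2
    (oracleAnswer π (followUp σ ind b x).1 (followUp σ ind b x).2)

theorem revealedPair_snd (π σ : Equiv.Perm X) (ind b : Bool) (x : X) :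
    (revealedPair π σ ind b x).2 = π (revealedPair π σ ind b x).1 := by
  cases ind <;> cases b <;> simp [revealedPair, queryPair, followUp, oracleAnswer]

theorem revealedPair_eq (π σ : Equiv.Perm X) (ind b : Bool) (x : X) :
    revealedPair π σ ind b x =
      ((revealedPair π σ ind b x).1, π (revealedPair π σ ind b x).1) :=
  Prod.ext rfl (revealedPair_snd π σ ind b x)

/-- For a forward query the two points are x and π⁻¹(σ x), and T differs from σ only if one of them
is in R. A backward query gives π⁻¹ x and σ⁻¹ x, the same test at the preimage under σ. -/
theorem oracleAnswer_eq_of_revealed_notMem {π σ T : Equiv.Perm X} {R : Finset X}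
    (hT : IsReprogramming π σ R T) {b : Bool} {x : X}
    (h : ∀ ind, (revealedPair π σ ind b x).1 ∉ R) : oracleAnswer T b x = oracleAnswer σ b x := by
  have h₁ := h false
  have h₂ := h true
  cases b <;>
    simp only [revealedPair, queryPair, followUp, oracleAnswer, Bool.not_true, Bool.not_false,
      if_true, Bool.false_eq_true, if_false] at h₁ h₂ ⊢
  · exact hT.on_compl x h₁ h₂
  · rw [Equiv.symm_apply_eq, hT.on_compl _ h₂ (by simpa using h₁)]
    simp

/-- If both points were in R, then σ would map one of them to the value of π at the other. Hence at
most one kind of follow-up query contributes for each measured query. -/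
theorem GenericOn.revealed_unique {π σ : Equiv.Perm X} {R : Finset X} (h : GenericOn π σ R)
    {b : Bool} {x : X} (h₁ : (revealedPair π σ false b x).1 ∈ R) :
    (revealedPair π σ true b x).1 ∉ R := by
  intro h₂
  cases b <;>
    simp only [revealedPair, queryPair, followUp, oracleAnswer, Bool.not_true, Bool.not_false,
      if_true, Bool.false_eq_true, if_false] at h₁ h₂
  · exact h _ h₁ _ h₂ (by simp)
  · exact h _ h₂ _ h₁ (by simp)

theorem revealedPair_injective (π σ : Equiv.Perm X) (ind b : Bool) :
    Function.Injective fun x => (revealedPair π σ ind b x).1 := by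
  intro x x' h
  cases ind <;> cases b <;>
    simpa [revealedPair, queryPair, followUp, oracleAnswer] using h

variable [DecidableEq X]

theorem reprogram_apply_fst (σ : Equiv.Perm X) (p : X × X) : reprogram σ p p.1 = p.2 := by
  simp [reprogram]

theorem reprogram_apply_symm (σ : Equiv.Perm X) (p : X × X) :
    reprogram σ p (σ.symm p.2) = σ p.1 := by
  simp [reprogram]

theorem reprogram_apply_of_ne {σ : Equiv.Perm X} {p : X × X} {x : X} (h₁ : x ≠ p.1)
    (h₂ : σ x ≠ p.2) : reprogram σ p x = σ x := by
  have : x ≠ σ.symm p.2 := fun h => h₂ (by simp [h])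
  simp [reprogram, Equiv.swap_apply_of_ne_of_ne h₁ this]

theorem GenericOn.reprogram_apply {π σ : Equiv.Perm X} {R : Finset X} (h : GenericOn π σ R)
    {e x : X} (he : e ∈ R) (hx : x ∈ R) (hne : x ≠ e) : reprogram σ (e, π e) x = σ x :=
  reprogram_apply_of_ne hne (h x hx e he)

theorem GenericOn.reprogram_erase {π σ : Equiv.Perm X} {R : Finset X} (h : GenericOn π σ R)
    {e : X} (he : e ∈ R) : GenericOn π (reprogram σ (e, π e)) (R.erase e) := by
  intro x hx x' hx'
  rw [Finset.mem_erase] at hx hx'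
  rw [h.reprogram_apply he hx.2 hx.1]
  exact h x hx.2 x' hx'.2

/-- By genericity the swaps for different points of R are disjoint, so they can be done one at a
time. This is the invariant that keeps T fixed while σ and R change along a branch. -/
theorem IsReprogramming.reprogram_erase {π σ T : Equiv.Perm X} {R : Finset X}
    (hT : IsReprogramming π σ R T) (h : GenericOn π σ R) {e : X} (he : e ∈ R) :
    IsReprogramming π (reprogram σ (e, π e)) (R.erase e) T where
  on_mem x hx := hT.on_mem x (Finset.mem_of_mem_erase hx)
  on_image x hx := by
    rw [Finset.mem_erase] at hx
    -- The swapped points are e and σ⁻¹(π e). Their new values are π e, whose preimage under π has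
    -- been erased, and σ e, which is not in π(R) by genericity; so neither satisfies the
    -- hypothesis.
    by_cases h₁ : x = e
    · subst h₁
      exact absurd (by rw [reprogram_apply_fst]; simp) hx.1
    by_cases h₂ : σ x = π e
    · have hx' : x = σ.symm (π e) := by simp [← h₂]
      have h₃ : reprogram σ (e, π e) x = σ e := by
        rw [hx']; exact reprogram_apply_symm σ (e, π e)
      rw [h₃] at hx
      exact absurd (by simp) (h e he _ hx.2)
    · have h₃ : reprogram σ (e, π e) x = σ x := reprogram_apply_of_ne h₁ h₂
      rw [h₃] at hx ⊢
      rw [hT.on_image x hx.2, h.reprogram_apply he hx.2 hx.1]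
  on_compl x hx hx' := by
    by_cases h₁ : x = e
    · subst h₁
      rw [hT.on_mem x he]
      exact (reprogram_apply_fst σ (x, π x)).symm
    by_cases h₂ : σ x = π e
    · have hx₂ : x = σ.symm (π e) := by simp [← h₂]
      have h₃ : reprogram σ (e, π e) x = σ e := by
        rw [hx₂]; exact reprogram_apply_symm σ (e, π e)
      rw [hT.on_image x (by simpa [h₂] using he), h₃, h₂]
      simp
    · have h₃ : reprogram σ (e, π e) x = σ x := reprogram_apply_of_ne h₁ h₂
      rw [h₃] at hx' ⊢
      have h₄ : π.symm (σ x) ≠ e := fun h => h₂ (by simp [← h])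
      exact hT.on_compl x (fun hR => hx (Finset.mem_erase.2 ⟨h₁, hR⟩))
        (fun hR => hx' (Finset.mem_erase.2 ⟨h₄, hR⟩))

/-- The query concerns one of the two points swapped for the revealed pair, and there T already has
its final value after this single swap. -/
theorem oracleAnswer_eq_of_revealed_mem {π σ T : Equiv.Perm X} {R : Finset X}
    (hT : IsReprogramming π σ R T) {ind b : Bool} {x : X}
    (he : (revealedPair π σ ind b x).1 ∈ R) :
    oracleAnswer T b x = oracleAnswer (reprogram σ (revealedPair π σ ind b x)) b x := by
  have h₁ := reprogram_apply_fst σ (revealedPair π σ ind b x)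
  have h₂ := reprogram_apply_symm σ (revealedPair π σ ind b x)
  generalize hρ : reprogram σ (revealedPair π σ ind b x) = ρ at h₁ h₂
  cases ind <;> cases b <;>
    simp only [revealedPair, queryPair, followUp, oracleAnswer, Bool.not_true, Bool.not_false,
      if_true, Bool.false_eq_true, if_false, Equiv.symm_apply_apply, Equiv.apply_symm_apply]
      at he h₁ h₂ ⊢
  · rw [hT.on_mem x he, h₁]
  · rw [(Equiv.symm_apply_eq ρ).2 h₁.symm, Equiv.symm_apply_eq, hT.on_mem _ he]
    simp
  · rw [hT.on_image x he, h₂]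
  · rw [(Equiv.symm_apply_eq ρ).2 h₂.symm, Equiv.symm_apply_eq, hT.on_image _ (by simpa using he)]
    simp

end Reprogramming

/-! ### Exchanging the real and the simulated permutation -/

section Exchange

variable {X : Type*}

theorem GenericOn.notMem {π σ : Equiv.Perm X} {R : Finset X} (h : GenericOn π σ R) {x : X}
    (hx : π.symm (σ x) ∈ R) : x ∉ R := fun hx' => h x hx' _ hx (by simp)

variable [DecidableEq X]

/-- Exchange every `x ∈ R` with the point that `σ` maps to `π x`. -/
def exchangeFun (π σ : Equiv.Perm X) (R : Finset X) (x : X) : X :=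
  if x ∈ R then σ.symm (π x) else if π.symm (σ x) ∈ R then π.symm (σ x) else x

theorem exchangeFun_of_mem (π σ : Equiv.Perm X) {R : Finset X} {x : X} (hx : x ∈ R) :
    exchangeFun π σ R x = σ.symm (π x) := if_pos hx

theorem GenericOn.exchangeFun_of_image {π σ : Equiv.Perm X} {R : Finset X}
    (h : GenericOn π σ R) {x : X} (hx : π.symm (σ x) ∈ R) :
    exchangeFun π σ R x = π.symm (σ x) := by
  rw [exchangeFun, if_neg (h.notMem hx), if_pos hx]

theorem exchangeFun_of_compl {π σ : Equiv.Perm X} {R : Finset X} {x : X} (hx : x ∉ R)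
    (hx' : π.symm (σ x) ∉ R) : exchangeFun π σ R x = x := by
  rw [exchangeFun, if_neg hx, if_neg hx']

theorem GenericOn.exchangeFun_involutive {π σ : Equiv.Perm X} {R : Finset X}
    (h : GenericOn π σ R) : Function.Involutive (exchangeFun π σ R) := by
  intro x
  by_cases hx : x ∈ R
  · rw [exchangeFun_of_mem π σ hx, h.exchangeFun_of_image (by simpa using hx)]
    simp
  by_cases hx' : π.symm (σ x) ∈ R
  · rw [h.exchangeFun_of_image hx', exchangeFun_of_mem π σ hx']
    simp
  · rw [exchangeFun_of_compl hx hx', exchangeFun_of_compl hx hx']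

/-- `exchangeFun` as a permutation; the identity if `σ` is not generic. -/
def exchange (π σ : Equiv.Perm X) (R : Finset X) : Equiv.Perm X :=
  if h : GenericOn π σ R then h.exchangeFun_involutive.toPerm else 1

theorem GenericOn.exchange_apply {π σ : Equiv.Perm X} {R : Finset X} (h : GenericOn π σ R)
    (x : X) : exchange π σ R x = exchangeFun π σ R x := by
  rw [exchange, dif_pos h]; rfl

theorem GenericOn.exchange_exchange {π σ : Equiv.Perm X} {R : Finset X} (h : GenericOn π σ R)
    (x : X) : exchange π σ R (exchange π σ R x) = x := by
  rw [h.exchange_apply, h.exchange_apply, h.exchangeFun_involutive]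

theorem GenericOn.isReprogramming {π σ : Equiv.Perm X} {R : Finset X} (h : GenericOn π σ R) :
    IsReprogramming π σ R ((exchange π σ R).trans σ) where
  on_mem x hx := by simp [h.exchange_apply, exchangeFun_of_mem π σ hx]
  on_image x hx := by simp [h.exchange_apply, h.exchangeFun_of_image hx]
  on_compl x hx hx' := by simp [h.exchange_apply, exchangeFun_of_compl hx hx']

theorem GenericOn.trans_exchange {π σ : Equiv.Perm X} {R : Finset X} (h : GenericOn π σ R) :
    GenericOn ((exchange π σ R).trans σ) ((exchange π σ R).trans π) R := by
  intro x hx x' hx' he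
  rw [h.isReprogramming.on_mem x' hx'] at he
  have he' : exchange π σ R x = x' := by simpa using he
  rw [h.exchange_apply, exchangeFun_of_mem π σ hx] at he'
  exact h x' hx' x hx (by simp [← he'])

/-- With τ the exchange, a point y of R is now sent to (π ∘ τ)⁻¹(π y) = τ y. The new pair thus
defines the same τ, and composing with it twice restores the old pair. -/
theorem GenericOn.exchange_trans_exchange {π σ : Equiv.Perm X} {R : Finset X}
    (h : GenericOn π σ R) :
    exchange ((exchange π σ R).trans σ) ((exchange π σ R).trans π) R = exchange π σ R := by
  ext y
  have h' := h.trans_exchange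
  rw [h'.exchange_apply]
  by_cases hy : y ∈ R
  · rw [exchangeFun_of_mem _ _ hy, h.isReprogramming.on_mem y hy, Equiv.symm_apply_eq,
      Equiv.trans_apply, h.exchange_exchange]
  by_cases hy' : ((exchange π σ R).trans σ).symm (((exchange π σ R).trans π) y) ∈ R
  · rw [h'.exchangeFun_of_image hy']
    have h₂ := h.isReprogramming.on_mem _ hy'
    rw [Equiv.apply_symm_apply, Equiv.trans_apply] at h₂
    exact (π.injective h₂).symm
  · rw [exchangeFun_of_compl hy hy']
    by_cases h₁ : π.symm (σ y) ∈ R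
    · exfalso
      apply hy'
      have h₂ : exchange π σ R y = π.symm (σ y) := by
        rw [h.exchange_apply, h.exchangeFun_of_image h₁]
      have h₃ : ((exchange π σ R).trans σ).symm (((exchange π σ R).trans π) y) = π.symm (σ y) := by
        rw [Equiv.symm_apply_eq, h.isReprogramming.on_mem _ h₁, Equiv.trans_apply, h₂]
      rwa [h₃]
    · rw [h.exchange_apply, exchangeFun_of_compl hy h₁]

/-- The pairs in `D` belong to the graph of `π`. -/
def AgreesOn (π : Equiv.Perm X) (D : Finset (X × X)) : Prop := ∀ p ∈ D, π p.1 = p.2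

instance (π : Equiv.Perm X) (D : Finset (X × X)) : Decidable (AgreesOn π D) := by
  unfold AgreesOn; infer_instance

variable [Fintype X]

/-- The sum is reindexed by the involution (π, σ) ↦ (σ ∘ τ, π ∘ τ). It preserves agreement with D
because the first entry still equals π on the points of D. -/
theorem sum_exchange {M : Type*} [AddCommMonoid M] (D : Finset (X × X))
    (g : Equiv.Perm X → M) :
    (∑ π, ∑ σ, if AgreesOn π D ∧ GenericOn π σ (D.image Prod.fst) then
        g ((exchange π σ (D.image Prod.fst)).trans σ) else 0) =
      ∑ π, ∑ σ, if AgreesOn π D ∧ GenericOn π σ (D.image Prod.fst) then g π else 0 := by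
  rw [← Fintype.sum_prod_type', ← Fintype.sum_prod_type', ← Finset.sum_filter,
    ← Finset.sum_filter]
  set R := D.image Prod.fst
  let i : Equiv.Perm X × Equiv.Perm X → Equiv.Perm X × Equiv.Perm X := fun p =>
    ((exchange p.1 p.2 R).trans p.2, (exchange p.1 p.2 R).trans p.1)
  have hmem : ∀ p ∈ Finset.univ.filter
      (fun p : Equiv.Perm X × Equiv.Perm X => AgreesOn p.1 D ∧ GenericOn p.1 p.2 R),
      i p ∈ Finset.univ.filter
      (fun p : Equiv.Perm X × Equiv.Perm X => AgreesOn p.1 D ∧ GenericOn p.1 p.2 R) := by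
    intro p hp
    rw [Finset.mem_filter] at hp ⊢
    refine ⟨Finset.mem_univ _, fun a ha => ?_, hp.2.2.trans_exchange⟩
    rw [hp.2.2.isReprogramming.on_mem a.1 (Finset.mem_image_of_mem _ ha)]
    exact hp.2.1 a ha
  have hinv : ∀ p ∈ Finset.univ.filter
      (fun p : Equiv.Perm X × Equiv.Perm X => AgreesOn p.1 D ∧ GenericOn p.1 p.2 R),
      i (i p) = p := by
    intro p hp
    have h := (Finset.mem_filter.1 hp).2.2
    have h' := h.exchange_trans_exchange
    refine Prod.ext ?_ ?_ <;> ext x <;> simp only [i, h', Equiv.trans_apply, h.exchange_exchange]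
  exact Finset.sum_nbij' i i hmem hmem hinv hinv fun _ _ => rfl

/-! ### Counting generic permutations -/

theorem card_filter_apply_eq (x y : X) :
    Fintype.card X * (Finset.univ.filter fun σ : Equiv.Perm X => σ x = y).card =
      Fintype.card (Equiv.Perm X) := by
  -- Composition with the transposition of y and z matches the fibres over y and z.
  have h : ∀ z, (Finset.univ.filter fun σ : Equiv.Perm X => σ x = z).card =
      (Finset.univ.filter fun σ : Equiv.Perm X => σ x = y).card := fun z =>
    Finset.card_bij' (fun σ _ => σ.trans (Equiv.swap y z)) (fun σ _ => σ.trans (Equiv.swap y z))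
      (by simp +contextual) (by simp +contextual) (by intros; ext; simp) (by intros; ext; simp)
  calc _ = ∑ z, (Finset.univ.filter fun σ : Equiv.Perm X => σ x = z).card := by simp [h]
    _ = (Finset.univ : Finset (Equiv.Perm X)).card :=
      (Finset.card_eq_sum_card_fiberwise (by simp)).symm
    _ = _ := Finset.card_univ

/-- Union bound over the at most k² events σ x = π x', each of probability 1/|X|. -/
theorem card_perm_le_card_genericOn (π : Equiv.Perm X) (R : Finset X) {k : ℕ} (hR : R.card ≤ k) :
    Fintype.card X * Fintype.card (Equiv.Perm X) ≤
      Fintype.card X * (Finset.univ.filter fun σ => GenericOn π σ R).card +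
        k ^ 2 * Fintype.card (Equiv.Perm X) := by
  have h₁ : Fintype.card (Equiv.Perm X) =
      (Finset.univ.filter fun σ => GenericOn π σ R).card +
        (Finset.univ.filter fun σ => ¬ GenericOn π σ R).card := by
    rw [Finset.card_filter_add_card_filter_not, Finset.card_univ]
  have h₂ : (Finset.univ.filter fun σ => ¬ GenericOn π σ R) ⊆
      (R ×ˢ R).biUnion fun p => Finset.univ.filter fun σ : Equiv.Perm X => σ p.1 = π p.2 := by
    intro σ hσ
    simp only [Finset.mem_filter, Finset.mem_univ, true_and, GenericOn, not_forall,
      not_not] at hσ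
    obtain ⟨x, hx, x', hx', he⟩ := hσ
    simp only [Finset.mem_biUnion, Finset.mem_product, Finset.mem_filter, Finset.mem_univ,
      true_and]
    exact ⟨(x, x'), ⟨hx, hx'⟩, he⟩
  have h₃ : Fintype.card X * (Finset.univ.filter fun σ => ¬ GenericOn π σ R).card ≤
      k ^ 2 * Fintype.card (Equiv.Perm X) := by
    calc _ ≤ Fintype.card X * ∑ p ∈ R ×ˢ R,
          (Finset.univ.filter fun σ : Equiv.Perm X => σ p.1 = π p.2).card := by
          gcongr
          exact (Finset.card_le_card h₂).trans Finset.card_biUnion_le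
      _ = R.card ^ 2 * Fintype.card (Equiv.Perm X) := by
          rw [Finset.mul_sum]
          simp only [card_filter_apply_eq, Finset.sum_const, Finset.card_product, smul_eq_mul, sq]
      _ ≤ _ := by gcongr
  nth_rewrite 1 [h₁]
  rw [mul_add]
  omega

end Exchange

/-! ### Sums of squared norms -/

/-- Cauchy–Schwarz for √β and √C. Unequal weights β let the unmeasured term carry a larger constant
than the measured ones. -/
theorem enorm_sq_sum_le {ι E : Type*} [NormedAddCommGroup E] (s : Finset ι) (v : ι → E)
    (β C : ι → ℝ≥0∞) (h : ∀ i ∈ s, ‖v i‖ₑ ^ 2 ≤ β i * C i) :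
    ‖∑ i ∈ s, v i‖ₑ ^ 2 ≤ (∑ i ∈ s, β i) * ∑ i ∈ s, C i := by
  have hsq : ∀ a : ℝ≥0∞, (a ^ (1 / 2 : ℝ)) ^ 2 = a := fun a => by
    rw [← ENNReal.rpow_natCast, ← ENNReal.rpow_mul]; norm_num
  have hsq' : ∀ a : ℝ≥0∞, (a ^ 2) ^ (1 / 2 : ℝ) = a := fun a => by
    rw [← ENNReal.rpow_natCast, ← ENNReal.rpow_mul]; norm_num
  have h₁ : ‖∑ i ∈ s, v i‖ₑ ≤ ∑ i ∈ s, β i ^ (1 / 2 : ℝ) * C i ^ (1 / 2 : ℝ) := by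
    refine (enorm_sum_le s v).trans (Finset.sum_le_sum fun i hi => ?_)
    rw [← ENNReal.mul_rpow_of_nonneg _ _ (by norm_num), ← hsq' ‖v i‖ₑ]
    exact ENNReal.rpow_le_rpow (h i hi) (by norm_num)
  have h₂ := ENNReal.inner_le_Lp_mul_Lq s (fun i => β i ^ (1 / 2 : ℝ))
    (fun i => C i ^ (1 / 2 : ℝ)) Real.HolderConjugate.two_two
  have h₃ : ∀ a : ℝ≥0∞, (a ^ (1 / 2 : ℝ)) ^ (2 : ℝ) = a := fun a => by
    rw [← ENNReal.rpow_mul]; norm_num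
  simp only [h₃] at h₂
  calc ‖∑ i ∈ s, v i‖ₑ ^ 2
      ≤ ((∑ i ∈ s, β i) ^ (1 / 2 : ℝ) * (∑ i ∈ s, C i) ^ (1 / 2 : ℝ)) ^ 2 := by
        gcongr; exact h₁.trans h₂
    _ = _ := by rw [mul_pow, hsq, hsq]

/-- The coordinates `i` of `ψ` with `f i = o`, the others being replaced by `0`. -/
noncomputable def maskLin {X W ι : Type*} (f : Reg X W → ι) (o : ι) :
    QState X W →ₗ[ℂ] QState X W := by
  classical exact
  { toFun := fun ψ => WithLp.toLp 2 fun i => if f i = o then ψ i else 0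
    map_add' := fun ψ φ => by ext i; by_cases h : f i = o <;> simp [h]
    map_smul' := fun c ψ => by ext i; by_cases h : f i = o <;> simp [h] }

theorem maskLin_apply {X W ι : Type*} (f : Reg X W → ι) (o : ι) (ψ : QState X W) (i : Reg X W)
    [Decidable (f i = o)] : maskLin f o ψ i = if f i = o then ψ i else 0 := by
  simp only [maskLin, LinearMap.coe_mk, AddHom.coe_mk]
  congr

theorem postMeasure_eq_maskLin {X W : Type*} (f : Reg X W → ℕ) (o : ℕ) (ψ : QState X W) :
    postMeasure f o ψ = maskLin f o ψ := by
  classical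
  ext i
  rw [maskLin_apply]
  simp only [postMeasure]

section Mask

variable {X W ι : Type*}

theorem sum_maskLin [Fintype ι] (f : Reg X W → ι) (ψ : QState X W) :
    ∑ o, maskLin f o ψ = ψ := by
  classical
  ext i
  simp [maskLin_apply]

theorem enorm_sq_eq_sum {κ : Type*} [Fintype κ] (ψ : EuclideanSpace ℂ κ) :
    ‖ψ‖ₑ ^ 2 = ∑ i, ‖ψ i‖ₑ ^ 2 := by
  have h : ‖ψ‖₊ ^ 2 = ∑ i, ‖ψ i‖₊ ^ 2 := by rw [EuclideanSpace.nnnorm_eq, NNReal.sq_sqrt]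
  simp only [enorm_eq_nnnorm]
  exact_mod_cast h

variable [Fintype X] [Fintype W]

theorem sum_enorm_sq_maskLin_le (f : Reg X W → ι) (s : Finset ι) (ψ : QState X W) :
    ∑ o ∈ s, ‖maskLin f o ψ‖ₑ ^ 2 ≤ ‖ψ‖ₑ ^ 2 := by
  classical
  simp only [enorm_sq_eq_sum, maskLin_apply]
  rw [Finset.sum_comm]
  refine Finset.sum_le_sum fun i _ => ?_
  have : ∀ o, ‖if f i = o then ψ i else 0‖ₑ ^ 2 = if f i = o then ‖ψ i‖ₑ ^ 2 else 0 := fun o => by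
    split_ifs <;> simp
  simp only [this, Finset.sum_ite_eq]
  split_ifs <;> simp

theorem enorm_maskLin_le (f : Reg X W → ι) (o : ι) (ψ : QState X W) :
    ‖maskLin f o ψ‖ₑ ^ 2 ≤ ‖ψ‖ₑ ^ 2 := by
  simpa using sum_enorm_sq_maskLin_le f {o} ψ

/-- If ψ = 0 the hypothesis forces φ = 0, so conditional probabilities need no separate case for the
zero state. -/
theorem enorm_sq_mul_div_of_le {ψ φ : QState X W} (h : ‖φ‖ₑ ^ 2 ≤ ‖ψ‖ₑ ^ 2) :
    ‖ψ‖ₑ ^ 2 * (‖φ‖ₑ ^ 2 / ‖ψ‖ₑ ^ 2) = ‖φ‖ₑ ^ 2 :=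
  ENNReal.mul_div_cancel' (fun h₀ => le_antisymm (h.trans h₀.le) zero_le)
    (fun h₀ => absurd h₀ (by simp))

/-- Two permutations that answer the query `(b, x)` alike have the same query unitary on the
span of the basis states that make this query. -/
theorem queryUnitary_maskLin_congr [AddCommGroup X] {σ τ : Equiv.Perm X} {b : Bool} {x : X}
    (h : oracleAnswer σ b x = oracleAnswer τ b x) (ψ : QState X W) :
    queryUnitary σ (maskLin (fun i => (i.1, i.2.1)) (b, x) ψ) =
      queryUnitary τ (maskLin (fun i => (i.1, i.2.1)) (b, x) ψ) := by
  classical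
  ext ⟨b', x', y, w⟩
  simp only [queryUnitary, LinearIsometryEquiv.piLpCongrLeft_apply, Equiv.piCongrLeft'_apply,
    maskLin_apply]
  simp only [queryPerm, Equiv.coe_fn_symm_mk, Prod.mk.injEq]
  by_cases h' : b' = b ∧ x' = x
  · obtain ⟨rfl, rfl⟩ := h'
    simp [h]
  · rw [if_neg h', if_neg h']

end Mask

/-! ### The runs of a game, independently of the oracle -/

/-- The sequence of the linear maps that an adversary applies in a run; `none` is a query. -/
abbrev QWord (X W : Type*) := List (Option (QState X W →ₗ[ℂ] QState X W))

/-- The number of queries in a word. -/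
def QWord.queries {X W : Type*} (w : QWord X W) : ℕ := w.countP Option.isNone

/-- The linear map that a word denotes when its queries are answered by `π`. -/
noncomputable def evalWord {X W : Type*} [Fintype X] [AddCommGroup X] [Fintype W]
    (π : Equiv.Perm X) : QWord X W → QState X W →ₗ[ℂ] QState X W
  | [] => LinearMap.id
  | some L :: w => evalWord π w ∘ₗ L
  | none :: w => evalWord π w ∘ₗ (queryUnitary π).toLinearEquiv.toLinearMap

/-- A weight on the runs, given by the word of the adversary and the set of input-output pairs that
the challenger has queried. -/
abbrev RunWeight (X W : Type*) := QWord X W → Finset (X × X) → ℝ≥0∞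

/-- The weight of the runs that start with the action `L` of the adversary. -/
def RunWeight.step {X W : Type*} (F : RunWeight X W) (L : Option (QState X W →ₗ[ℂ] QState X W)) :
    RunWeight X W := fun w D => F (L :: w) D

/-- The weight of the runs in which the challenger first queries the pair `p`. -/
def RunWeight.record {X W : Type*} [DecidableEq X] (F : RunWeight X W) (p : X × X) :
    RunWeight X W := fun w D => F w (insert p D)

theorem agreesOn_insert {X : Type*} [DecidableEq X] {π : Equiv.Perm X} {p : X × X}
    {D : Finset (X × X)} : AgreesOn π (insert p D) ↔ π p.1 = p.2 ∧ AgreesOn π D := by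
  simp [AgreesOn]

theorem apply_queryPair {X : Type*} {π : Equiv.Perm X} {inv : Bool} {x y : X} :
    π (queryPair inv x y).1 = (queryPair inv x y).2 ↔ y = oracleAnswer π inv x := by
  cases inv <;> simp [queryPair, oracleAnswer, eq_comm, Equiv.eq_symm_apply]

section Runs

variable {X W MA MC : Type*} [Fintype X] [Fintype W]

/-- The total weight of the runs of a quantum adversary up to its next message. -/
noncomputable def QuantumAlg.runFree
    (κ : MA → (MC → QuantumAlg X W MC MA) → RunWeight X W → ℝ≥0∞) :
    QuantumAlg X W MC MA → RunWeight X W → ℝ≥0∞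
  | .halt, _ => 0
  | .gate U next, F => next.runFree κ (F.step (some U.toLinearEquiv.toLinearMap))
  | .measure f next, F =>
      ∑ o ∈ Finset.univ.image f, (next o).runFree κ (F.step (some (maskLin f o)))
  | .query next, F => next.runFree κ (F.step none)
  | .send m next, F => κ m next F

theorem QuantumAlg.runFree_sum {ι : Type*} (s : Finset ι) (c : ι → ℝ≥0∞)
    {κ : MA → (MC → QuantumAlg X W MC MA) → RunWeight X W → ℝ≥0∞}
    (hκ : ∀ m A (F : ι → RunWeight X W),
      κ m A (fun w D => ∑ i ∈ s, c i * F i w D) = ∑ i ∈ s, c i * κ m A (F i))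
    (A : QuantumAlg X W MC MA) (F : ι → RunWeight X W) :
    A.runFree κ (fun w D => ∑ i ∈ s, c i * F i w D) = ∑ i ∈ s, c i * A.runFree κ (F i) := by
  induction A generalizing F with
  | halt => simp [runFree]
  | gate U next ih => exact ih fun i => (F i).step _
  | measure f next ih =>
    simp only [runFree, Finset.mul_sum]
    rw [Finset.sum_comm]
    exact Finset.sum_congr rfl fun o _ => ih o fun i => (F i).step _
  | query next ih => exact ih fun i => (F i).step _
  | send m next => exact hκ m next F

theorem QuantumAlg.runFree_mono {n : ℕ} {P : Finset (X × X) → Prop}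
    {κ : MA → (MC → QuantumAlg X W MC MA) → RunWeight X W → ℝ≥0∞}
    (hκ : ∀ m A n (F F' : RunWeight X W), (∀ m', (A m').AtMostQueries n) →
      (∀ w D, w.queries ≤ n → P D → F w D ≤ F' w D) → κ m A F ≤ κ m A F')
    (A : QuantumAlg X W MC MA) (hA : A.AtMostQueries n) (F F' : RunWeight X W)
    (hF : ∀ w D, w.queries ≤ n → P D → F w D ≤ F' w D) :
    A.runFree κ F ≤ A.runFree κ F' := by
  induction A generalizing n F F' with
  | halt => exact le_rfl
  | gate U next ih =>
    exact ih hA _ _ fun w D hw hD => hF _ D (by simpa [QWord.queries] using hw) hD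
  | measure f next ih =>
    exact Finset.sum_le_sum fun o _ => ih o (hA o) _ _ fun w D hw hD =>
      hF _ D (by simpa [QWord.queries] using hw) hD
  | query next ih =>
    cases n with
    | zero => exact hA.elim
    | succ n =>
      exact ih hA _ _ fun w D hw hD => hF _ D (by simpa [QWord.queries] using hw) hD
  | send m next => exact hκ m next n F F' hA hF

theorem QuantumAlg.runTurn_eq_runFree [AddCommGroup X] {π : Equiv.Perm X}
    {κ : MA → (MC → QuantumAlg X W MC MA) → QState X W → ℝ≥0∞}
    {κ' : MA → (MC → QuantumAlg X W MC MA) → RunWeight X W → ℝ≥0∞}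
    {Φ : QState X W → RunWeight X W}
    (hκ : ∀ m A ψ, κ m A ψ = κ' m A (Φ ψ))
    (hsome : ∀ ψ L, (Φ ψ).step (some L) = Φ (L ψ))
    (hnone : ∀ ψ, (Φ ψ).step none = Φ (queryUnitary π ψ))
    (A : QuantumAlg X W MC MA) (ψ : QState X W) :
    A.runTurn π κ ψ = A.runFree κ' (Φ ψ) := by
  induction A generalizing ψ with
  | halt => rfl
  | gate U next ih => rw [runTurn, ih, runFree, hsome]; rfl
  | measure f next ih =>
    rw [runTurn, runFree]
    exact Finset.sum_congr rfl fun o _ => by rw [ih, hsome, postMeasure_eq_maskLin]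
  | query next ih => rw [runTurn, ih, runFree, hnone]
  | send m next => exact hκ m next ψ

variable [DecidableEq X]

/-- The total weight of the accepting runs, over all answers to the queries of the challenger. -/
noncomputable def Challenger.acceptFree :
    Challenger X MA MC → (MC → QuantumAlg X W MC MA) → RunWeight X W → ℝ≥0∞
  | .ret b, _, F => if b then F [] ∅ else 0
  | .toss p next, A, F => ∑' i, p i * Challenger.acceptFree (next i) A F
  | .query inv x next, A, F =>
      ∑ y, Challenger.acceptFree (next y) A (F.record (queryPair inv x y))
  | .send m next, A, F =>
      (A m).runFree (fun m' A' F' => Challenger.acceptFree (next m') A' F') F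

theorem Challenger.acceptFree_sum {ι : Type*} (s : Finset ι) (c : ι → ℝ≥0∞)
    (G : Challenger X MA MC) (A : MC → QuantumAlg X W MC MA) (F : ι → RunWeight X W) :
    G.acceptFree A (fun w D => ∑ i ∈ s, c i * F i w D) = ∑ i ∈ s, c i * G.acceptFree A (F i) := by
  induction G generalizing A F with
  | ret b => cases b <;> simp [acceptFree]
  | toss p next ih =>
    simp only [acceptFree, ih, Finset.mul_sum, ← ENNReal.tsum_mul_left]
    rw [Summable.tsum_finsetSum fun _ _ => ENNReal.summable]
    exact Finset.sum_congr rfl fun i _ => tsum_congr fun j => mul_left_comm _ _ _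
  | query inv x next ih =>
    simp only [acceptFree, Finset.mul_sum]
    rw [Finset.sum_comm]
    exact Finset.sum_congr rfl fun y _ => ih y A fun i => (F i).record _
  | send m next ih =>
    exact QuantumAlg.runFree_sum s c (fun m' A' F' => ih m' A' F') (A m) F

theorem Challenger.acceptFree_zero (G : Challenger X MA MC) (A : MC → QuantumAlg X W MC MA) :
    G.acceptFree A (fun _ _ => 0) = 0 := by
  simpa using G.acceptFree_sum (∅ : Finset Unit) (fun _ => 0) A (fun _ _ _ => 0)

/-- Only runs within both query bounds occur, so the weights need to be compared only there. -/
theorem Challenger.acceptFree_mono {n k : ℕ} (G : Challenger X MA MC) (hG : G.AtMostQueries k)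
    (A : MC → QuantumAlg X W MC MA) (hA : ∀ m, (A m).AtMostQueries n) (F F' : RunWeight X W)
    (hF : ∀ w D, w.queries ≤ n → D.card ≤ k → F w D ≤ F' w D) :
    G.acceptFree A F ≤ G.acceptFree A F' := by
  induction G generalizing n k A F F' with
  | ret b =>
    cases b
    · exact le_rfl
    · simpa [acceptFree] using hF [] ∅ (by simp [QWord.queries]) (by simp)
  | toss p next ih =>
    exact ENNReal.tsum_le_tsum fun i => mul_le_mul_right (ih i (hG i) A hA F F' hF) _
  | query inv x next ih =>
    cases k with
    | zero => exact hG.elim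
    | succ k =>
      exact Finset.sum_le_sum fun y _ => ih y (hG y) A hA _ _ fun w D hw hD =>
        hF w _ hw ((Finset.card_insert_le _ _).trans (Nat.succ_le_succ hD))
  | send m next ih =>
    exact QuantumAlg.runFree_mono (P := fun D => D.card ≤ k)
      (fun m' A' n' F₁ F₂ hA' hF' => ih m' (hG m') A' hA' F₁ F₂ hF') (A m) (hA m) F F' hF

variable [AddCommGroup X]

/-- The probability of a run when the oracle is `π` and the adversary starts in the state `ψ`. -/
noncomputable def bornWeight (π : Equiv.Perm X) (ψ : QState X W) : RunWeight X W :=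
  fun w D => if AgreesOn π D then ‖evalWord π w ψ‖ₑ ^ 2 else 0

theorem bornWeight_record (π : Equiv.Perm X) (ψ : QState X W) (inv : Bool) (x y : X) :
    (bornWeight π ψ).record (queryPair inv x y) =
      if y = oracleAnswer π inv x then bornWeight π ψ else fun _ _ => 0 := by
  funext w D
  simp only [RunWeight.record, bornWeight, agreesOn_insert, apply_queryPair]
  split_ifs <;> simp_all [bornWeight]

/-- Summing over all answers to a challenger's query is harmless: a wrong answer puts a pair outside
the graph of π into D, which makes the weight vanish. -/
theorem Challenger.acceptQuantum_eq_acceptFree (π : Equiv.Perm X) (G : Challenger X MA MC)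
    (A : MC → QuantumAlg X W MC MA) (ψ : QState X W) :
    G.acceptQuantum π A ψ = G.acceptFree A (bornWeight π ψ) := by
  induction G generalizing A ψ with
  | ret b => cases b <;> simp [acceptQuantum, acceptFree, bornWeight, AgreesOn, evalWord]
  | toss p next ih => simp only [acceptQuantum, acceptFree, ih]
  | query inv x next ih =>
    simp only [acceptQuantum, acceptFree, ih, bornWeight_record]
    rw [Finset.sum_eq_single (oracleAnswer π inv x)]
    · rw [if_pos rfl]
    · intro y _ hy
      rw [if_neg hy, acceptFree_zero]
    · simp
  | send m next ih =>
    exact QuantumAlg.runTurn_eq_runFree (fun m' A' ψ' => ih m' A' ψ') (fun _ _ => rfl)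
      (fun _ => rfl) (A m) ψ

end Runs

/-! ### Expansion of a run along the measured queries -/

/-- The measured query `(b, x)` and the choices made with it: whether the follow-up query is the
inverse one, and whether the permutation is reprogrammed only after the query is answered. -/
abbrev Slot (X : Type*) := Bool × Bool × Bool × X

/-- The pair that is revealed by the follow-up query of the slot `s`. -/
def slotPair {X : Type*} (π σ : Equiv.Perm X) (s : Slot X) : X × X := revealedPair π σ s.1 s.2.2.1 s.2.2.2

/-- For each value of the three bits, the revealed point determines x. This is the origin of the 8
in the theorem. -/
theorem card_filter_slotPair_le {X : Type*} [Fintype X] [DecidableEq X] (π σ : Equiv.Perm X) (R : Finset X) :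
    (Finset.univ.filter fun s : Slot X => (slotPair π σ s).1 ∈ R).card ≤ 8 * R.card := by
  have : ((Finset.univ : Finset (Bool × Bool × Bool)) ×ˢ R).card = 8 * R.card := by
    simp [Finset.card_product]
  rw [← this]
  refine Finset.card_le_card_of_injOn
    (fun s => ((s.1, s.2.1, s.2.2.1), (slotPair π σ s).1)) (fun s hs => ?_) ?_
  · simpa using hs
  · rintro ⟨ind, aft, b, x⟩ _ ⟨ind', aft', b', x'⟩ _ he
    simp only [Prod.mk.injEq] at he
    obtain ⟨⟨rfl, rfl, rfl⟩, hx⟩ := he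
    have := revealedPair_injective π σ ind b hx
    subst this
    rfl

/-- The first two terms of the binomial expansion. With a = 8n+1 it is the recursion for the
constants (8n+1)^r when one query is added. -/
theorem pow_add_mul_pow_le (a r : ℕ) :
    a ^ (r + 1) + 8 * (r + 1) * a ^ r ≤ (a + 8) ^ (r + 1) := by
  induction r with
  | zero => simp
  | succ r ih =>
    calc a ^ (r + 1 + 1) + 8 * (r + 1 + 1) * a ^ (r + 1)
        ≤ (a ^ (r + 1) + 8 * (r + 1) * a ^ r) * (a + 8) := by
          have : (a ^ (r + 1) + 8 * (r + 1) * a ^ r) * (a + 8) =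
              a ^ (r + 1 + 1) + 8 * (r + 1 + 1) * a ^ (r + 1) + 64 * (r + 1) * a ^ r := by ring
          omega
      _ ≤ (a + 8) ^ (r + 1) * (a + 8) := by gcongr
      _ = _ := (pow_succ _ _).symm

section Expansion

variable {X W : Type*}

/-- The part of `ψ` that makes the query `(b, x)`. -/
noncomputable def queryPart (b : Bool) (x : X) : QState X W →ₗ[ℂ] QState X W :=
  maskLin (fun i => (i.1, i.2.1)) (b, x)

variable [Fintype X] [Fintype W] [AddCommGroup X]

/-- The unnormalized state after the query in slot `s`, where `σ'` is the reprogrammed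
permutation. -/
noncomputable def slotState (σ σ' : Equiv.Perm X) (s : Slot X) (ψ : QState X W) : QState X W :=
  queryUnitary (if s.2.1 then σ else σ') (queryPart s.2.2.1 s.2.2.2 ψ)

/-- The sum of the weights of all runs of the simulation with at most `r` measured queries, whose
revealed pairs are in distinct points of `R`. -/
noncomputable def branchWeight [DecidableEq X] (π : Equiv.Perm X) :
    QWord X W → ℕ → Finset X → Equiv.Perm X → QState X W → ℝ≥0∞
  | [], _, _, _, ψ => ‖ψ‖ₑ ^ 2
  | some L :: w, r, R, σ, ψ => branchWeight π w r R σ (L ψ)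
  | none :: w, 0, R, σ, ψ => branchWeight π w 0 R σ (queryUnitary σ ψ)
  | none :: w, r + 1, R, σ, ψ =>
      branchWeight π w (r + 1) R σ (queryUnitary σ ψ) +
        ∑ s : Slot X, if (slotPair π σ s).1 ∈ R then
          branchWeight π w r (R.erase (slotPair π σ s).1) (reprogram σ (slotPair π σ s))
            (slotState σ (reprogram σ (slotPair π σ s)) s ψ) else 0

variable [DecidableEq X]

/-- Split ψ by the query (b, x). On each part U_T is U_σ, or it is U_σ' for the permutation σ'
reprogrammed at one pair; then U_σ' − U_σ gives the two terms of opposite sign. -/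
theorem queryUnitary_eq_add_sum {π σ T : Equiv.Perm X} {R : Finset X}
    (hT : IsReprogramming π σ R T) (h : GenericOn π σ R) (ψ : QState X W) :
    queryUnitary T ψ = queryUnitary σ ψ +
      ∑ s : Slot X, if (slotPair π σ s).1 ∈ R then
        (if s.2.1 then (-1 : ℂ) else 1) • slotState σ (reprogram σ (slotPair π σ s)) s ψ else 0 := by
  have hsum : ∀ τ : Equiv.Perm X, queryUnitary τ ψ =
      ∑ p : Bool × X, queryUnitary τ (queryPart p.1 p.2 ψ) := fun τ => by
    rw [← map_sum]
    exact congrArg _ (sum_maskLin _ ψ).symm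
  have hpart : ∀ p : Bool × X, queryUnitary T (queryPart p.1 p.2 ψ) =
      queryUnitary σ (queryPart p.1 p.2 ψ) + ∑ ind : Bool, ∑ aft : Bool,
        if (slotPair π σ (ind, aft, p)).1 ∈ R then
          (if aft then (-1 : ℂ) else 1) •
            slotState σ (reprogram σ (slotPair π σ (ind, aft, p))) (ind, aft, p) ψ else 0 := by
    rintro ⟨b, x⟩
    simp only [Fintype.sum_bool, slotPair, slotState, if_true, Bool.false_eq_true, if_false,
      one_smul, neg_smul]
    by_cases h₁ : (revealedPair π σ false b x).1 ∈ R
    · rw [if_neg (h.revealed_unique h₁), if_neg (h.revealed_unique h₁), if_pos h₁, if_pos h₁,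
        queryPart, queryUnitary_maskLin_congr (oracleAnswer_eq_of_revealed_mem hT h₁)]
      abel
    by_cases h₂ : (revealedPair π σ true b x).1 ∈ R
    · rw [if_neg h₁, if_neg h₁, if_pos h₂, if_pos h₂,
        queryPart, queryUnitary_maskLin_congr (oracleAnswer_eq_of_revealed_mem hT h₂)]
      abel
    · rw [if_neg h₁, if_neg h₁, if_neg h₂, if_neg h₂, queryPart, queryUnitary_maskLin_congr
        (oracleAnswer_eq_of_revealed_notMem hT fun ind => by cases ind <;> assumption)]
      simp
  have hslot : ∀ f : Slot X → QState X W,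
      ∑ s, f s = ∑ p : Bool × X, ∑ ind, ∑ aft, f (ind, aft, p) := fun f => by
    simp only [Fintype.sum_prod_type, Fintype.sum_bool, Finset.sum_add_distrib]
    abel
  rw [hsum T, hsum σ, Finset.sum_congr rfl fun p _ => hpart p, Finset.sum_add_distrib, hslot]

/-- At each query the weights in Cauchy–Schwarz are the constants of the induction hypotheses for
the remaining word, with r+1 or r measurements left. -/
theorem enorm_sq_evalWord_le {π T : Equiv.Perm X} (w : QWord X W) {n r : ℕ}
    (hw : w.queries ≤ n) (R : Finset X) (hR : R.card ≤ r) (σ : Equiv.Perm X)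
    (h : GenericOn π σ R) (hT : IsReprogramming π σ R T) (ψ : QState X W) :
    ‖evalWord T w ψ‖ₑ ^ 2 ≤ (8 * n + 1) ^ r * branchWeight π w r R σ ψ := by
  induction w generalizing n r R σ ψ with
  | nil =>
    simp only [evalWord, branchWeight, LinearMap.id_apply]
    refine le_mul_of_one_le_left zero_le (one_le_pow₀ ?_)
    simp
  | cons L w ih =>
    cases L with
    | some L => exact ih (by simpa [QWord.queries] using hw) R hR σ h hT (L ψ)
    | none =>
      obtain ⟨n, rfl⟩ : ∃ m, n = m + 1 := Nat.exists_eq_succ_of_ne_zero fun hn => by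
        simp [QWord.queries, hn] at hw
      have hw' : QWord.queries w ≤ n := by simpa [QWord.queries] using hw
      cases r with
      | zero =>
        -- With no points left to reveal, T = σ and nothing has to be measured any more.
        obtain rfl : R = ∅ := by simpa using hR
        have := ih hw' ∅ hR σ h hT (queryUnitary σ ψ)
        simpa [evalWord, branchWeight, hT.eq_of_empty] using this
      | succ r =>
        set S := Finset.univ.filter fun s : Slot X => (slotPair π σ s).1 ∈ R with hS
        set σ' := fun s => reprogram σ (slotPair π σ s) with hσ'
        let v : Option (Slot X) → QState X W := fun o => evalWord T w (o.elim (queryUnitary σ ψ)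
          fun s => (if s.2.1 then (-1 : ℂ) else 1) • slotState σ (σ' s) s ψ)
        let β : Option (Slot X) → ℝ≥0∞ := fun o => o.elim ((8 * n + 1) ^ (r + 1))
          fun _ => (8 * n + 1) ^ r
        let C : Option (Slot X) → ℝ≥0∞ := fun o => o.elim
          (branchWeight π w (r + 1) R σ (queryUnitary σ ψ))
          fun s => branchWeight π w r (R.erase (slotPair π σ s).1) (σ' s) (slotState σ (σ' s) s ψ)
        have hv : evalWord T (none :: w) ψ = ∑ o ∈ Finset.insertNone S, v o := by
          rw [Finset.sum_insertNone]
          simp only [v, Option.elim_none, Option.elim_some, evalWord]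
          rw [← map_sum, ← map_add, hS, Finset.sum_filter]
          exact congrArg _ (queryUnitary_eq_add_sum hT h ψ)
        have hC : branchWeight π (none :: w) (r + 1) R σ ψ = ∑ o ∈ Finset.insertNone S, C o := by
          rw [Finset.sum_insertNone, hS, Finset.sum_filter]
          rfl
        have hβ : ∑ o ∈ Finset.insertNone S, β o ≤ (8 * (n + 1 : ℕ) + 1) ^ (r + 1) := by
          rw [Finset.sum_insertNone]
          simp only [β, Option.elim_none, Option.elim_some, Finset.sum_const, nsmul_eq_mul]
          have h₁ : S.card ≤ 8 * (r + 1) := (card_filter_slotPair_le π σ R).trans (by omega)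
          have h₂ := pow_add_mul_pow_le (8 * n + 1) r
          have h₃ : (8 * n + 1) ^ (r + 1) + S.card * (8 * n + 1) ^ r ≤
              (8 * (n + 1) + 1) ^ (r + 1) :=
            (Nat.add_le_add_left (Nat.mul_le_mul_right _ h₁) _).trans
              (h₂.trans_eq (by ring))
          exact_mod_cast h₃
        rw [hv, hC]
        refine (enorm_sq_sum_le _ v β C fun o ho => ?_).trans (mul_le_mul_left hβ _)
        cases o with
        | none => exact ih hw' R hR σ h hT _
        | some s =>
          have hs : (slotPair π σ s).1 ∈ R := by
            simpa [hS] using ho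
          have hpair : slotPair π σ s = ((slotPair π σ s).1, π (slotPair π σ s).1) :=
            revealedPair_eq _ _ _ _ _
          have hσs : σ' s = reprogram σ ((slotPair π σ s).1, π (slotPair π σ s).1) :=
            congrArg (reprogram σ) hpair
          -- The sign is lost in the norm, so the classical simulation need not reproduce it.
          have hnorm : ‖v (some s)‖ₑ ^ 2 = ‖evalWord T w (slotState σ (σ' s) s ψ)‖ₑ ^ 2 := by
            simp only [v, Option.elim_some]
            split_ifs <;> simp
          rw [hnorm]
          refine ih hw' _ ?_ (σ' s) ?_ ?_ _
          · rw [Finset.card_erase_of_mem hs]; omega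
          · rw [hσs]; exact h.reprogram_erase hs
          · rw [hσs]; exact hT.reprogram_erase h hs

end Expansion

/-! ### The classical simulation -/

open Classical in
/-- A discrete distribution with at least the weights `w`, if they sum to at most `1`. -/
noncomputable def PMF.dominating {ι : Type*} [Nonempty ι] (w : ι → ℝ≥0∞) : PMF ι :=
  if h : ∑' i, w i ≠ 0 ∧ ∑' i, w i ≠ ⊤ then PMF.normalize w h.1 h.2 else
    PMF.pure (Classical.arbitrary ι)

/-- Normalization divides by a total of at most 1; if the total is 0, all weights are 0. -/
theorem PMF.le_dominating {ι : Type*} [Nonempty ι] {w : ι → ℝ≥0∞} (hw : ∑' i, w i ≤ 1) (i : ι) :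
    w i ≤ PMF.dominating w i := by
  have htop : ∑' i, w i ≠ ⊤ := ne_top_of_le_ne_top ENNReal.one_ne_top hw
  by_cases h : ∑' i, w i = 0
  · simp [ENNReal.tsum_eq_zero.1 h i]
  · rw [dominating, dif_pos ⟨h, htop⟩, PMF.normalize_apply]
    exact le_mul_of_one_le_right zero_le (ENNReal.one_le_inv.2 hw)

/-- Sample `i` with probability at least `w i` and continue with `next i`. -/
noncomputable def ClassicalAlg.choose {X In Out R ι : Type*} [Countable ι] [Nonempty ι]
    (w : ι → ℝ≥0∞) (next : ι → ClassicalAlg X In Out R) : ClassicalAlg X In Out R :=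
  .toss ((PMF.dominating w).map (exists_injective_nat ι).choose)
    (Function.extend (exists_injective_nat ι).choose next fun _ => next (Classical.arbitrary ι))

theorem ClassicalAlg.AtMostQueries.choose {X In Out R ι : Type*} [Countable ι] [Nonempty ι]
    {w : ι → ℝ≥0∞} {next : ι → ClassicalAlg X In Out R} {k : ℕ}
    (h : ∀ i, (next i).AtMostQueries k) : (ClassicalAlg.choose w next).AtMostQueries k := by
  intro j
  by_cases hj : ∃ i, (exists_injective_nat ι).choose i = j
  · obtain ⟨i, rfl⟩ := hj
    rw [(exists_injective_nat ι).choose_spec.extend_apply]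
    exact h i
  · rw [Function.extend_apply' _ _ _ hj]
    exact h _

theorem ClassicalAlg.le_runTurn_choose {X MA MC ι : Type*} [Countable ι] [Nonempty ι]
    {w : ι → ℝ≥0∞} (hw : ∑' i, w i ≤ 1) (next : ι → ClassicalAlg X MC MA Unit)
    (π : Equiv.Perm X) (κ : MA → ClassicalAdversary X MA MC → ℝ≥0∞) :
    ∑' i, w i * (next i).runTurn π κ ≤ (ClassicalAlg.choose w next).runTurn π κ := by
  rw [choose, runTurn]
  have hinj := (exists_injective_nat ι).choose_spec
  refine le_trans (ENNReal.tsum_le_tsum fun i => ?_)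
    (ENNReal.tsum_comp_le_tsum_of_injective hinj _)
  rw [hinj.extend_apply]
  refine mul_le_mul_left ((PMF.le_dominating hw i).trans ?_) _
  rw [PMF.map_apply]
  exact (by simp : PMF.dominating w i ≤ _).trans (ENNReal.le_tsum i)

section Simulation

variable {X W MA MC : Type*} [Fintype X] [Fintype W]

/-- The probability with which the simulation chooses to measure a query in slot `s`, or no
query (`none`). -/
noncomputable def slotProb (n r : ℕ) (ψ : QState X W) : Option (Slot X) → ℝ≥0∞
  | none => (8 * n + 1) ^ (r + 1) / (8 * (n + 1 : ℕ) + 1) ^ (r + 1)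
  | some s => (8 * n + 1) ^ r / (8 * (n + 1 : ℕ) + 1) ^ (r + 1) *
      (‖queryPart s.2.2.1 s.2.2.2 ψ‖ₑ ^ 2 / ‖ψ‖ₑ ^ 2)

/-- The parts are orthogonal, and each occurs once for every choice of the two bits that do not
affect it. -/
theorem sum_queryPart_le (ψ : QState X W) :
    ∑ s : Slot X, ‖queryPart s.2.2.1 s.2.2.2 ψ‖ₑ ^ 2 ≤ 4 * ‖ψ‖ₑ ^ 2 := by
  have h : ∑ p : Bool × X, ‖queryPart p.1 p.2 ψ‖ₑ ^ 2 ≤ ‖ψ‖ₑ ^ 2 :=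
    sum_enorm_sq_maskLin_le _ Finset.univ ψ
  rw [Fintype.sum_prod_type]
  simp only [Fintype.sum_prod_type (α₂ := Bool × X), Fintype.sum_bool]
  calc _ = 4 * ∑ p : Bool × X, ‖queryPart p.1 p.2 ψ‖ₑ ^ 2 := by ring
    _ ≤ _ := by gcongr

theorem enorm_queryPart_le (b : Bool) (x : X) (ψ : QState X W) :
    ‖queryPart b x ψ‖ₑ ^ 2 ≤ ‖ψ‖ₑ ^ 2 := enorm_maskLin_le _ _ ψ

theorem mul_slotProb_none (n r : ℕ) (ψ : QState X W) :
    (8 * (n + 1 : ℕ) + 1 : ℝ≥0∞) ^ (r + 1) * slotProb n r ψ none = (8 * n + 1) ^ (r + 1) :=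
  ENNReal.mul_div_cancel' (fun h => absurd h (by simp))
    (fun h => absurd h (by finiteness))

theorem mul_slotProb_some (n r : ℕ) (ψ : QState X W) (s : Slot X) :
    (8 * (n + 1 : ℕ) + 1 : ℝ≥0∞) ^ (r + 1) * ‖ψ‖ₑ ^ 2 * slotProb n r ψ (some s) =
      (8 * n + 1) ^ r * ‖queryPart s.2.2.1 s.2.2.2 ψ‖ₑ ^ 2 := by
  rw [slotProb, mul_mul_mul_comm, enorm_sq_mul_div_of_le (enorm_queryPart_le _ _ ψ)]
  congr 1
  exact ENNReal.mul_div_cancel' (fun h => absurd h (by simp))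
    (fun h => absurd h (by finiteness))

theorem tsum_slotProb_le (n r : ℕ) (ψ : QState X W) : ∑' o, slotProb n r ψ o ≤ 1 := by
  have h₁ : ∑ s : Slot X, ‖queryPart s.2.2.1 s.2.2.2 ψ‖ₑ ^ 2 / ‖ψ‖ₑ ^ 2 ≤ 8 := by
    simp only [div_eq_mul_inv, ← Finset.sum_mul]
    refine (mul_le_mul_left (sum_queryPart_le ψ) _).trans ?_
    rw [mul_assoc]
    calc _ ≤ (4 : ℝ≥0∞) * 1 := by gcongr; exact ENNReal.mul_inv_le_one _
      -- The bound 4 would do; 8 fits the recursion of the constants.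
      _ ≤ 8 := by norm_num
  rw [tsum_fintype, Fintype.sum_option]
  simp only [slotProb, ← Finset.mul_sum]
  calc _ ≤ ((8 * n + 1) ^ (r + 1) / (8 * (n + 1 : ℕ) + 1) ^ (r + 1) +
        (8 * n + 1) ^ r / (8 * (n + 1 : ℕ) + 1) ^ (r + 1) * 8 : ℝ≥0∞) := by gcongr
    _ = ((8 * n + 1) ^ (r + 1) + (8 * n + 1) ^ r * 8) / (8 * (n + 1 : ℕ) + 1) ^ (r + 1) := by
      rw [ENNReal.add_div, ENNReal.mul_div_right_comm]
    _ ≤ 1 := by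
      refine ENNReal.div_le_of_le_mul ?_
      rw [one_mul]
      have h₂ := pow_add_mul_pow_le (8 * n + 1) r
      have h₃ : (8 * n + 1) ^ (r + 1) + (8 * n + 1) ^ r * 8 ≤ (8 * (n + 1) + 1) ^ (r + 1) := by
        refine le_trans ?_ (h₂.trans_eq (by ring))
        rw [mul_comm _ 8]
        gcongr
        omega
      exact_mod_cast h₃

variable [AddCommGroup X] [DecidableEq X]

/-- The classical simulation of a quantum algorithm with at most `n` quantum queries, from the state
`ψ` and with the simulated permutation `σ`, that measures at most `r` of the queries. -/
noncomputable def QuantumAlg.simulate :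
    QuantumAlg X W MC MA → ℕ → ℕ → Equiv.Perm X → QState X W → ClassicalAlg X MC MA Unit
  | .halt, _, _, _, _ => .ret ()
  | .gate U next, n, r, σ, ψ => next.simulate n r σ (U ψ)
  | .measure f next, n, r, σ, ψ =>
      ClassicalAlg.choose
        (fun o => if o ∈ Finset.univ.image f then ‖maskLin f o ψ‖ₑ ^ 2 / ‖ψ‖ₑ ^ 2 else 0)
        fun o => (next o).simulate n r σ (maskLin f o ψ)
  | .query _, 0, _, _, _ => .ret ()
  | .query next, n + 1, 0, σ, ψ => next.simulate n 0 σ (queryUnitary σ ψ)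
  | .query next, n + 1, r + 1, σ, ψ =>
      ClassicalAlg.choose (slotProb n r ψ) fun o => match o with
        | none => next.simulate n (r + 1) σ (queryUnitary σ ψ)
        | some s =>
          .query (followUp σ s.1 s.2.2.1 s.2.2.2).1 (followUp σ s.1 s.2.2.1 s.2.2.2).2 fun a =>
            let σ' := reprogram σ (queryPair (followUp σ s.1 s.2.2.1 s.2.2.2).1
              (followUp σ s.1 s.2.2.1 s.2.2.2).2 a)
            next.simulate n r σ' (slotState σ σ' s ψ)
  | .send m next, n, r, σ, ψ => .send m fun m' => (next m').simulate n r σ ψ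

theorem QuantumAlg.atMostQueries_simulate (A : QuantumAlg X W MC MA) (n r : ℕ)
    (σ : Equiv.Perm X) (ψ : QState X W) : (A.simulate n r σ ψ).AtMostQueries r := by
  induction A generalizing n r σ ψ with
  | halt => trivial
  | gate U next ih => exact ih n r σ _
  | measure f next ih => exact ClassicalAlg.AtMostQueries.choose fun o => ih o n r σ _
  | query next ih =>
    rcases n with _ | n
    · trivial
    rcases r with _ | r
    · exact ih n 0 σ _
    · refine ClassicalAlg.AtMostQueries.choose fun o => ?_
      rcases o with _ | s
      · exact ih n (r + 1) σ _
      · exact fun a => ih n r _ _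
  | send m next ih => exact fun m' => ih m' n r σ ψ

/-- The weight of the runs of the simulation, where `R D` is the set of the points that remain to be
revealed if the challenger queries the pairs in `D`; runs with `R D = none` do not count. -/
noncomputable def simWeight (π : Equiv.Perm X) (r : ℕ) (σ : Equiv.Perm X) (ψ : QState X W)
    (R : Finset (X × X) → Option (Finset X)) : RunWeight X W :=
  fun w D => (R D).elim 0 fun R => branchWeight π w r R σ ψ

/-- Remove `e` from the remaining points; runs in which it is not among them do not count. -/
def eraseFrom (R : Finset (X × X) → Option (Finset X)) (e : X) (D : Finset (X × X)) :
    Option (Finset X) :=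
  (R D).bind fun S => if e ∈ S then some (S.erase e) else none

theorem simWeight_step_none_succ (π : Equiv.Perm X) (r : ℕ) (σ : Equiv.Perm X) (ψ : QState X W)
    (R : Finset (X × X) → Option (Finset X)) :
    (simWeight π (r + 1) σ ψ R).step none = fun w D => ∑ o : Option (Slot X), 1 * (match o with
      | none => simWeight π (r + 1) σ (queryUnitary σ ψ) R
      | some s => simWeight π r (reprogram σ (slotPair π σ s))
          (slotState σ (reprogram σ (slotPair π σ s)) s ψ)
          (eraseFrom R (slotPair π σ s).1)) w D := by
  funext w D
  rw [Fintype.sum_option]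
  simp only [RunWeight.step, simWeight, eraseFrom, one_mul]
  cases R D with
  | none => simp
  | some S =>
    simp only [Option.elim_some, branchWeight, Option.bind_some]
    congr 1
    refine Finset.sum_congr rfl fun s _ => ?_
    split_ifs <;> rfl

/-- Each sampling probability, times the constant before the query, is at least the constant of the
induction hypothesis times the matching ratio of squared norms. The simulation ignores R, whose only
effect is to discard runs. The continuation κ is the challenger's, and `hκ` is provided by the
induction over the challenger. -/
theorem QuantumAlg.runFree_simWeight_le {π : Equiv.Perm X}
    {κ : MA → (MC → QuantumAlg X W MC MA) → RunWeight X W → ℝ≥0∞}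
    {κ' : MA → ClassicalAdversary X MA MC → ℝ≥0∞}
    {P : (Finset (X × X) → Option (Finset X)) → Prop}
    (hP : ∀ R e, P R → P (eraseFrom R e))
    (hadd : ∀ m A (F : Option (Slot X) → RunWeight X W),
      κ m A (fun w D => ∑ i, 1 * F i w D) = ∑ i, 1 * κ m A (F i))
    (hκ : ∀ m A n r σ ψ R, (∀ m', (A m').AtMostQueries n) → P R →
      κ m A (simWeight π r σ ψ R) ≤
        (8 * n + 1) ^ r * ‖ψ‖ₑ ^ 2 * κ' m fun m' => (A m').simulate n r σ ψ)
    (A : QuantumAlg X W MC MA) (n r : ℕ) (hA : A.AtMostQueries n) (σ : Equiv.Perm X)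
    (ψ : QState X W) (R : Finset (X × X) → Option (Finset X)) (hR : P R) :
    A.runFree κ (simWeight π r σ ψ R) ≤
      (8 * n + 1) ^ r * ‖ψ‖ₑ ^ 2 * (A.simulate n r σ ψ).runTurn π κ' := by
  induction A generalizing n r σ ψ R with
  | halt => exact zero_le
  | gate U next ih =>
    refine (ih n r hA σ (U ψ) R hR).trans_eq ?_
    rw [simulate]
    simp
  | measure f next ih =>
    rw [runFree, simulate]
    set wt : ℕ → ℝ≥0∞ := fun o =>
      if o ∈ Finset.univ.image f then ‖maskLin f o ψ‖ₑ ^ 2 / ‖ψ‖ₑ ^ 2 else 0 with hwt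
    have hsum : ∀ c : ℕ → ℝ≥0∞, ∑' o, wt o * c o =
        ∑ o ∈ Finset.univ.image f, ‖maskLin f o ψ‖ₑ ^ 2 / ‖ψ‖ₑ ^ 2 * c o := fun c => by
      rw [tsum_eq_sum (s := Finset.univ.image f) fun o ho => by
        rw [hwt]; simp only [if_neg ho, zero_mul]]
      exact Finset.sum_congr rfl fun o ho => by rw [hwt]; simp only [if_pos ho]
    have hw : ∑' o, wt o ≤ 1 := by
      have := hsum fun _ => 1
      simp only [mul_one] at this
      rw [this]
      simp only [div_eq_mul_inv, ← Finset.sum_mul]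
      exact (mul_le_mul_left (sum_enorm_sq_maskLin_le f _ ψ) _).trans (ENNReal.mul_inv_le_one _)
    refine le_trans ?_ (mul_le_mul_right (ClassicalAlg.le_runTurn_choose hw _ π κ') _)
    rw [hsum, Finset.mul_sum]
    refine Finset.sum_le_sum fun o _ => ?_
    refine (ih o n r (hA o) σ (maskLin f o ψ) R hR).trans_eq ?_
    conv_lhs => rw [← enorm_sq_mul_div_of_le (enorm_maskLin_le f o ψ)]
    ring
  | query next ih =>
    cases n with
    | zero => exact hA.elim
    | succ n =>
      cases r with
      | zero =>
        refine (ih n 0 hA σ (queryUnitary σ ψ) R hR).trans_eq ?_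
        rw [simulate]
        simp
      | succ r =>
        rw [runFree, simulate, simWeight_step_none_succ, QuantumAlg.runFree_sum _ _ hadd]
        refine le_trans ?_ (mul_le_mul_right
          (ClassicalAlg.le_runTurn_choose (tsum_slotProb_le n r ψ) _ π κ') _)
        rw [tsum_fintype, Finset.mul_sum]
        refine Finset.sum_le_sum fun o _ => ?_
        rw [one_mul]
        cases o with
        | none =>
          refine (ih n (r + 1) hA σ (queryUnitary σ ψ) R hR).trans_eq ?_
          rw [← mul_slotProb_none n r ψ]
          simp only [LinearIsometryEquiv.enorm_map]
          ring
        | some s =>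
          refine (ih n r hA _ _ _ (hP _ _ hR)).trans_eq ?_
          rw [← mul_assoc, mul_slotProb_some]
          simp only [slotState, LinearIsometryEquiv.enorm_map, ClassicalAlg.runTurn]
          rfl
  | send m next => exact hκ m next n r σ ψ R hA hR

theorem simWeight_record {π : Equiv.Perm X} {R : Finset (X × X) → Option (Finset X)}
    (hR : ∀ D, R D ≠ none → AgreesOn π D) {r : ℕ} {σ : Equiv.Perm X} {ψ : QState X W}
    {inv : Bool} {x y : X} (hy : y ≠ oracleAnswer π inv x) :
    (simWeight π r σ ψ R).record (queryPair inv x y) = fun _ _ => 0 := by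
  funext w D
  have : R (insert (queryPair inv x y) D) = none := by
    by_contra h
    exact hy (apply_queryPair.1 (agreesOn_insert.1 (hR _ h)).1)
  simp [RunWeight.record, simWeight, this]

theorem Challenger.acceptFree_simWeight_le (π : Equiv.Perm X) (G : Challenger X MA MC)
    (A : MC → QuantumAlg X W MC MA) (n r : ℕ) (hA : ∀ m, (A m).AtMostQueries n)
    (σ : Equiv.Perm X) (ψ : QState X W) (R : Finset (X × X) → Option (Finset X))
    (hR : ∀ D, R D ≠ none → AgreesOn π D) :
    G.acceptFree A (simWeight π r σ ψ R) ≤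
      (8 * n + 1) ^ r * ‖ψ‖ₑ ^ 2 *
        G.acceptClassical π fun m => (A m).simulate n r σ ψ := by
  induction G generalizing A n r σ ψ R with
  | ret b =>
    cases b
    · simp [acceptFree]
    · simp only [acceptFree, acceptClassical, simWeight, if_true, mul_one]
      cases R ∅ with
      | none => exact zero_le
      | some S =>
        exact le_mul_of_one_le_left zero_le (one_le_pow₀ (by simp))
  | toss p next ih =>
    rw [acceptFree, acceptClassical, ← ENNReal.tsum_mul_left]
    refine ENNReal.tsum_le_tsum fun i => ?_
    rw [mul_left_comm]
    exact mul_le_mul_right (ih i A n r hA σ ψ R hR) _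
  | query inv x next ih =>
    rw [acceptFree, acceptClassical, Finset.sum_eq_single (oracleAnswer π inv x)]
    -- R is a function of the pairs still to be queried, so the pair just recorded is absorbed into
    -- it.
    · exact ih _ A n r hA σ ψ (fun D => R (insert _ D)) fun D hD => (agreesOn_insert.1 (hR _ hD)).2
    · intro y _ hy
      rw [simWeight_record hR hy, acceptFree_zero]
    · simp
  | send m next ih =>
    refine QuantumAlg.runFree_simWeight_le (P := fun R => ∀ D, R D ≠ none → AgreesOn π D)
      (fun R e hR D hD => hR D fun h => hD (by simp [eraseFrom, h]))
      (fun m' A' F => acceptFree_sum _ _ _ A' F)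
      (fun m' A' n' r' σ' ψ' R' hA' hR' => ih m' A' n' r' hA' σ' ψ' R' hR')
      (A m) n r (hA m) σ ψ R hR

end Simulation

/-! ### The lifting theorem -/

theorem toReal_sum_uniform {X : Type*} [Fintype X] [DecidableEq X]
    (f : Equiv.Perm X → ℝ≥0∞) :
    (∑ π, PMF.uniformOfFintype (Equiv.Perm X) π * f π).toReal =
      (∑ π, f π).toReal / Fintype.card (Equiv.Perm X) := by
  simp only [PMF.uniformOfFintype_apply, ← Finset.mul_sum]
  rw [ENNReal.toReal_mul, ENNReal.toReal_inv, ENNReal.toReal_natCast, mul_comm, div_eq_mul_inv]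

section Lifting

variable {X W MA MC : Type*}

theorem ClassicalAlg.runTurn_le_one {π : Equiv.Perm X}
    {κ : MA → ClassicalAdversary X MA MC → ℝ≥0∞} (hκ : ∀ m B, κ m B ≤ 1)
    (B : ClassicalAlg X MC MA Unit) : B.runTurn π κ ≤ 1 := by
  induction B with
  | ret => exact zero_le
  | toss p next ih =>
    calc _ ≤ ∑' i, p i * 1 := ENNReal.tsum_le_tsum fun i => mul_le_mul_right (ih i) _
      _ = 1 := by simp [p.tsum_coe]
  | query inv x next ih => exact ih _
  | send m next => exact hκ m next

theorem Challenger.acceptClassical_le_one (π : Equiv.Perm X) (G : Challenger X MA MC)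
    (B : ClassicalAdversary X MA MC) : G.acceptClassical π B ≤ 1 := by
  induction G generalizing B with
  | ret b => cases b <;> simp [acceptClassical]
  | toss p next ih =>
    calc _ ≤ ∑' i, p i * 1 := ENNReal.tsum_le_tsum fun i => mul_le_mul_right (ih i B) _
      _ = 1 := by simp [p.tsum_coe]
  | query inv x next ih => exact ih _ B
  | send m next ih => exact ClassicalAlg.runTurn_le_one (fun m' B' => ih m' B') (B m)

variable [Fintype X] [DecidableEq X] [AddCommGroup X] [Fintype W]

/-- The points of the pairs in `D`, if these belong to the graph of `π`. -/
def pointsOf (π : Equiv.Perm X) (D : Finset (X × X)) : Option (Finset X) :=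
  if AgreesOn π D then some (D.image Prod.fst) else none

/-- With the run fixed, so is R. Counting generic σ introduces the second permutation, the exchange
turns π into T, and the expansion along measured queries bounds what results. -/
theorem sum_bornWeight_le {k q : ℕ} (ψ : QState X W) (w : QWord X W) (D : Finset (X × X))
    (hw : w.queries ≤ q) (hD : D.card ≤ k) :
    ∑ π, ((Fintype.card X * Fintype.card (Equiv.Perm X) -
        k ^ 2 * Fintype.card (Equiv.Perm X) : ℕ) : ℝ≥0∞) * bornWeight π ψ w D ≤
      ∑ p : Equiv.Perm X × Equiv.Perm X, (Fintype.card X * (8 * q + 1) ^ k : ℝ≥0∞) *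
        simWeight p.1 k p.2 ψ (pointsOf p.1) w D := by
  set R := D.image Prod.fst with hRdef
  have hR : R.card ≤ k := Finset.card_image_le.trans hD
  calc _ ≤ ∑ π, (Fintype.card X : ℝ≥0∞) * ∑ σ,
        if AgreesOn π D ∧ GenericOn π σ R then ‖evalWord π w ψ‖ₑ ^ 2 else 0 := by
        refine Finset.sum_le_sum fun π _ => ?_
        by_cases h : AgreesOn π D
        · have hc : Fintype.card X * Fintype.card (Equiv.Perm X) -
              k ^ 2 * Fintype.card (Equiv.Perm X) ≤
              Fintype.card X * (Finset.univ.filter fun σ => GenericOn π σ R).card :=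
            Nat.sub_le_iff_le_add.2 (card_perm_le_card_genericOn π R hR)
          simp only [bornWeight, h, true_and, if_true]
          rw [← Finset.sum_filter, Finset.sum_const, nsmul_eq_mul, ← mul_assoc]
          gcongr
          exact_mod_cast hc
        · simp [bornWeight, h]
    _ = (Fintype.card X : ℝ≥0∞) * ∑ π, ∑ σ, if AgreesOn π D ∧ GenericOn π σ R then
          ‖evalWord ((exchange π σ R).trans σ) w ψ‖ₑ ^ 2 else 0 := by
        rw [← Finset.mul_sum, sum_exchange D fun T => ‖evalWord T w ψ‖ₑ ^ 2]
    _ ≤ _ := by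
        rw [Fintype.sum_prod_type, Finset.mul_sum]
        refine Finset.sum_le_sum fun π _ => ?_
        rw [Finset.mul_sum]
        refine Finset.sum_le_sum fun σ _ => ?_
        by_cases h : AgreesOn π D ∧ GenericOn π σ R
        · rw [if_pos h, mul_assoc]
          simp only [simWeight, pointsOf, if_pos h.1, Option.elim_some]
          gcongr
          exact enorm_sq_evalWord_le w hw R hR σ h.2 h.2.isReprogramming ψ
        · rw [if_neg h, mul_zero]
          exact zero_le

theorem sum_acceptQuantum_le {k q : ℕ} {G : Challenger X MA MC} (hG : G.AtMostQueries k)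
    {A : MC → QuantumAlg X W MC MA} (hA : ∀ m, (A m).AtMostQueries q) (ψ : QState X W) :
    ((Fintype.card X * Fintype.card (Equiv.Perm X) -
        k ^ 2 * Fintype.card (Equiv.Perm X) : ℕ) : ℝ≥0∞) * ∑ π, G.acceptQuantum π A ψ ≤
      Fintype.card X * (8 * q + 1) ^ (2 * k) * ‖ψ‖ₑ ^ 2 *
        ∑ σ, ∑ π, G.acceptClassical π fun m => (A m).simulate q k σ ψ := by
  simp only [Challenger.acceptQuantum_eq_acceptFree]
  rw [Finset.mul_sum, ← Challenger.acceptFree_sum]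
  refine (G.acceptFree_mono hG A hA _ _ fun w D => sum_bornWeight_le ψ w D).trans ?_
  rw [Challenger.acceptFree_sum, Fintype.sum_prod_type_right, Finset.mul_sum]
  refine Finset.sum_le_sum fun σ _ => ?_
  rw [Finset.mul_sum]
  refine Finset.sum_le_sum fun π _ => ?_
  refine (mul_le_mul_right (G.acceptFree_simWeight_le π A q k hA σ ψ (pointsOf π)
    fun D hD => ?_) _).trans_eq (by ring)
  by_contra h
  exact hD (if_neg h)

end Lifting

theorem mainTheorem2 {X W MA MC : Type*} [Fintype X] [DecidableEq X] [AddCommGroup X] [Fintype W]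
    (k q : ℕ) (G : Challenger X MA MC) (hG : G.AtMostQueries k)
    (A : QuantumAdversary X W MA MC) (hA : ∀ m, (A.strategy m).AtMostQueries q) :
    ∃ B : ClassicalAdversary X MA MC,
      (∀ m, (B m).AtMostQueries k) ∧
      classicalWinProb G B ≥
        (1 - (k : ℝ) ^ 2 / (Fintype.card X : ℝ)) / (8 * (q : ℝ) + 1) ^ (2 * k) *
          quantumWinProb G A := by
  let B : Equiv.Perm X → ClassicalAdversary X MA MC := fun σ m =>
    (A.strategy m).simulate q k σ A.init
  let S : Equiv.Perm X → ℝ≥0∞ := fun σ => ∑ π, G.acceptClassical π (B σ)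
  -- A best fixed σ does at least as well as the average over σ.
  obtain ⟨σ, -, hσ⟩ := Finset.exists_max_image Finset.univ S Finset.univ_nonempty
  refine ⟨B σ, fun m => (A.strategy m).atMostQueries_simulate q k σ A.init, ?_⟩
  set N := Fintype.card X with hN
  set P := Fintype.card (Equiv.Perm X) with hP
  set Q : ℝ≥0∞ := ∑ π, G.acceptQuantum π A.strategy A.init with hQ
  have hNpos : (0 : ℝ) < N := by exact_mod_cast (Fintype.card_pos : 0 < Fintype.card X)
  have hPpos : (0 : ℝ) < P := by
    exact_mod_cast (Fintype.card_pos : 0 < Fintype.card (Equiv.Perm X))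
  have hinit : ‖A.init‖ₑ = 1 := by rw [← ofReal_norm, A.norm_init, ENNReal.ofReal_one]
  have hmain : ((N * P - k ^ 2 * P : ℕ) : ℝ≥0∞) * Q ≤
      (N * (8 * q + 1) ^ (2 * k)) * (P * S σ) := by
    refine (sum_acceptQuantum_le hG hA A.init).trans ?_
    rw [hinit, one_pow, mul_one]
    gcongr
    exact (Finset.sum_le_card_nsmul _ S (S σ) fun τ hτ => hσ τ hτ).trans_eq
      (by rw [nsmul_eq_mul, Finset.card_univ])
  have hS : S σ ≠ ⊤ := ENNReal.sum_ne_top.2 fun π _ =>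
    ne_top_of_le_ne_top ENNReal.one_ne_top (G.acceptClassical_le_one π (B σ))
  have hreal : ((N * P - k ^ 2 * P : ℕ) : ℝ) * Q.toReal ≤
      (N * (8 * q + 1) ^ (2 * k)) * (P * (S σ).toReal) := by
    have := ENNReal.toReal_mono (by finiteness) hmain
    have hM : ((8 * q + 1 : ℝ≥0∞)).toReal = 8 * q + 1 := by
      rw [show (8 * q + 1 : ℝ≥0∞) = ((8 * q + 1 : ℕ) : ℝ≥0∞) by push_cast; rfl,
        ENNReal.toReal_natCast]
      push_cast
      rfl
    simpa only [ENNReal.toReal_mul, ENNReal.toReal_pow, ENNReal.toReal_natCast, hM] using this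
  -- The truncated difference is at least the real one, which also covers k² > |X|.
  have hsub : (N * P - k ^ 2 * P : ℝ) ≤ ((N * P - k ^ 2 * P : ℕ) : ℝ) := by
    rw [sub_le_iff_le_add]
    exact_mod_cast le_tsub_add
  have hle : (N * P - k ^ 2 * P : ℝ) * Q.toReal ≤
      (N * (8 * q + 1) ^ (2 * k)) * (P * (S σ).toReal) :=
    (mul_le_mul_of_nonneg_right hsub ENNReal.toReal_nonneg).trans hreal
  have hMpos : (0 : ℝ) < (8 * q + 1) ^ (2 * k) := by positivity
  rw [ge_iff_le, classicalWinProb, quantumWinProb, toReal_sum_uniform, toReal_sum_uniform,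
    ← mul_div_assoc]
  refine div_le_div_of_nonneg_right ?_ hPpos.le
  rw [div_mul_eq_mul_div, div_le_iff₀ hMpos]
  refine le_of_mul_le_mul_left ?_ (mul_pos hNpos hPpos)
  calc (N * P : ℝ) * ((1 - (k : ℝ) ^ 2 / N) * Q.toReal)
      = (N * P - k ^ 2 * P : ℝ) * Q.toReal := by field_simp
    _ ≤ _ := hle
    _ = _ := by ring
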